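/- Let $d\ge 1$ be an integer, $a<b$ real numbers, $1<p<\infty$, $p'=p/(p-1)$, and $0<\alpha<1$. For $f\in L^1(a,b;\mathbb{R}^d)$ and $\beta>0$ let $$I^{\beta}_-[f](t)=\frac{1}{\Gamma(\beta)}\int_a^t\frac{f(y)}{(t-y)^{1-\beta}}\,dy$$ denote the left Riemann--Liouville fractional integral, and for $u\in W^{1,p}=W^{1,p}(a,b;\mathbb{R}^d)$ with weak derivative $\dot u$ let ${}_cD^\alpha_-[u]=I^{1-\alpha}_-[\dot u]$ denote the left Caputo fractional derivative. Let $E$ be a non-empty weakly closed subset of $W^{1,p}$, let $L:(\mathbb{R}^d)^4\times[a,b]\to\mathbb{R}$, $(x_1,x_2,x_3,x_4,t)\mapsto L(x_1,x_2,x_3,x_4,t)$, be of class $C^1$, let $\partial_iL$ denote its gradient with respect to $x_i$, and set $$\mathcal{L}(u)=\int_a^b L\big(u,I^\alpha_-[u],\dot u,{}_cD^\alpha_-[u],t\big)\,dt .$$ Assume that 1. (regularity) for every $u\in W^{1,p}$, evaluated along $\big(u,I^\alpha_-[u],\dot u,{}_cD^\alpha_-[u],t\big)$, the functions $L$ and $\partial_1L$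 belong to $L^1(a,b)$, and $\partial_2L$, $\partial_3L$, $\partial_4L$ belong to $L^{p'}(a,b)$; 2. (coercivity on $E$) $\mathcal{L}(u)\to+\infty$ as $\|u\|_{W^{1,p}}\to\infty$ with $u\in E$; 3. (convexity) for every $t\in[a,b]$ the function $L(\cdot,t)$ is convex on $(\mathbb{R}^d)^4$. Then $\mathcal{L}$ has a minimizer on $E$: there exists $u\in E$ with $\mathcal{L}(u)\le\mathcal{L}(v)$ for all $v\in E$. -/

import Mathlib

open MeasureTheory Set Filter Topology
open scoped ENNReal ContDiff

noncomputable section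

namespace FracTonelli

/-- The Euclidean space of dimension `d`. -/
abbrev Vec (d : ℕ) : Type := EuclideanSpace ℝ (Fin d)

/-- Lebesgue measure on the open interval `(a, b)`. -/
abbrev intervalMeasure (a b : ℝ) : Measure ℝ := volume.restrict (Ioo a b)

/-- The Lebesgue space `L^p(a, b; ℝ^d)`. -/
abbrev LpSpace (d : ℕ) (a b : ℝ) (p : ℝ≥0∞) : Type :=
  ↥(Lp (Vec d) p (intervalMeasure a b))

/-- Real-valued test functions: smooth, with compact support contained in `(a, b)`. -/
structure IsTestFunction (a b : ℝ) (φ : ℝ → ℝ) : Prop where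
  contDiff : ContDiff ℝ ∞ φ
  hasCompactSupport : HasCompactSupport φ
  tsupport_subset : tsupport φ ⊆ Ioo a b

/-- `v` is the weak derivative of `u` on `(a, b)`. -/
def IsWeakDeriv {d : ℕ} (a b : ℝ) (u v : ℝ → Vec d) : Prop :=
  ∀ φ : ℝ → ℝ, IsTestFunction a b φ →
    ∫ t in Ioo a b, deriv φ t • u t = -∫ t in Ioo a b, φ t • v t

theorem integrable_smul_Lp {d : ℕ} {a b : ℝ} {p : ℝ≥0∞} [hp : Fact (1 ≤ p)] {ψ : ℝ → ℝ}
    (hc : Continuous ψ) (hs : HasCompactSupport ψ) (u : LpSpace d a b p) :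
    Integrable (fun t => ψ t • (u : ℝ → Vec d) t) (intervalMeasure a b) := by
  obtain ⟨C, hC⟩ := hs.exists_bound_of_continuous hc
  exact ((Lp.memLp u).integrable hp.out).bdd_smul C hc.aestronglyMeasurable
    (Eventually.of_forall hC)

theorem IsWeakDeriv.add {d : ℕ} {a b : ℝ} {p : ℝ≥0∞} [Fact (1 ≤ p)]
    {u₁ v₁ u₂ v₂ : LpSpace d a b p} (h₁ : IsWeakDeriv a b u₁ v₁) (h₂ : IsWeakDeriv a b u₂ v₂) :
    IsWeakDeriv a b (u₁ + u₂ : LpSpace d a b p) (v₁ + v₂ : LpSpace d a b p) := by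
  have key : ∀ (ψ : ℝ → ℝ), Continuous ψ → HasCompactSupport ψ → ∀ f g : LpSpace d a b p,
      ∫ t in Ioo a b, ψ t • ((f + g : LpSpace d a b p) : ℝ → Vec d) t
        = (∫ t in Ioo a b, ψ t • (f : ℝ → Vec d) t)
          + ∫ t in Ioo a b, ψ t • (g : ℝ → Vec d) t := by
    intro ψ hc hs f g
    rw [← integral_add (integrable_smul_Lp hc hs f) (integrable_smul_Lp hc hs g)]
    refine integral_congr_ae ?_
    filter_upwards [Lp.coeFn_add f g] with t ht
    rw [ht, Pi.add_apply, smul_add]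
  intro φ hφ
  rw [key _ (hφ.contDiff.continuous_deriv (by simp)) hφ.hasCompactSupport.deriv,
    key _ hφ.contDiff.continuous hφ.hasCompactSupport, h₁ φ hφ, h₂ φ hφ, neg_add]

theorem IsWeakDeriv.smul {d : ℕ} {a b : ℝ} {p : ℝ≥0∞}
    {u v : LpSpace d a b p} (c : ℝ) (h : IsWeakDeriv a b u v) :
    IsWeakDeriv a b (c • u : LpSpace d a b p) (c • v : LpSpace d a b p) := by
  have key : ∀ (ψ : ℝ → ℝ) (f : LpSpace d a b p),
      ∫ t in Ioo a b, ψ t • ((c • f : LpSpace d a b p) : ℝ → Vec d) t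
        = c • ∫ t in Ioo a b, ψ t • (f : ℝ → Vec d) t := by
    intro ψ f
    rw [← integral_smul]
    refine integral_congr_ae ?_
    filter_upwards [Lp.coeFn_smul c f] with t ht
    rw [ht, Pi.smul_apply, smul_comm]
  intro φ hφ
  rw [key, key, h φ hφ, smul_neg]

theorem IsWeakDeriv.zero {d : ℕ} {a b : ℝ} {p : ℝ≥0∞} :
    IsWeakDeriv a b (0 : LpSpace d a b p) (0 : LpSpace d a b p) := by
  have key : ∀ (ψ : ℝ → ℝ),
      ∫ t in Ioo a b, ψ t • ((0 : LpSpace d a b p) : ℝ → Vec d) t = 0 := by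
    intro ψ
    rw [← integral_zero ℝ (Vec d) (μ := intervalMeasure a b)]
    refine integral_congr_ae ?_
    filter_upwards [Lp.coeFn_zero (Vec d) p (intervalMeasure a b)] with t ht
    rw [ht, Pi.zero_apply, smul_zero]
  intro φ hφ
  rw [key, key, neg_zero]

/-- The Sobolev space `W^{1,p}(a, b; ℝ^d)`. An element `u` is stored together with its weak
derivative (which is unique as an element of `L^p`), as a pair in `L^p × L^p`; the norm is
`(‖u‖_p ^ p + ‖u'‖_p ^ p) ^ (1/p)` for finite `p`. -/
def Sobolev (d : ℕ) (a b : ℝ) (p : ℝ≥0∞) [Fact (1 ≤ p)] :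
    Submodule ℝ (WithLp p (LpSpace d a b p × LpSpace d a b p)) where
  carrier := {w | IsWeakDeriv a b w.fst w.snd}
  add_mem' h₁ h₂ := IsWeakDeriv.add h₁ h₂
  zero_mem' := IsWeakDeriv.zero
  smul_mem' c _ h := IsWeakDeriv.smul c h

/-- The underlying function of an element of `W^{1,p}`. -/
def Sobolev.fn {d : ℕ} {a b : ℝ} {p : ℝ≥0∞} [Fact (1 ≤ p)] (u : Sobolev d a b p) :
    ℝ → Vec d :=
  (u.1.fst : LpSpace d a b p)

/-- The weak derivative of an element of `W^{1,p}`. -/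
def Sobolev.dot {d : ℕ} {a b : ℝ} {p : ℝ≥0∞} [Fact (1 ≤ p)] (u : Sobolev d a b p) :
    ℝ → Vec d :=
  (u.1.snd : LpSpace d a b p)

/-- The left Riemann--Liouville fractional integral of order `α` with base point `a`. -/
def leftRL {d : ℕ} (a α : ℝ) (f : ℝ → Vec d) (t : ℝ) : Vec d :=
  (Real.Gamma α)⁻¹ • ∫ y in a..t, ((t - y) ^ (1 - α))⁻¹ • f y

/-- The left Caputo fractional derivative of order `α` (for `0 < α < 1`) of an element of `W^{1,p}`. -/
def leftCaputo {d : ℕ} {a b : ℝ} {p : ℝ≥0∞} [Fact (1 ≤ p)] (α : ℝ) (u : Sobolev d a b p) :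
    ℝ → Vec d :=
  leftRL a (1 - α) (Sobolev.dot u)

/-- The type of `(x₁, x₂, x₃, x₄)`. -/
abbrev Vec4 (d : ℕ) : Type := Vec d × Vec d × Vec d × Vec d

/-- The curve `t ↦ (u, I^α u, u', D^α u)(t)`. -/
def jet {d : ℕ} {a b : ℝ} {p : ℝ≥0∞} [Fact (1 ≤ p)] (α : ℝ) (u : Sobolev d a b p)
    (t : ℝ) : Vec4 d :=
  (Sobolev.fn u t, leftRL a α (Sobolev.fn u) t, Sobolev.dot u t, leftCaputo α u t)

/-- The partial gradient of `L` in its first argument. -/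
def partial₁ {d : ℕ} (L : Vec4 d × ℝ → ℝ) (x : Vec4 d) (t : ℝ) : Vec d :=
  gradient (fun y => L ((y, x.2.1, x.2.2.1, x.2.2.2), t)) x.1

/-- The partial gradient of `L` in its second argument. -/
def partial₂ {d : ℕ} (L : Vec4 d × ℝ → ℝ) (x : Vec4 d) (t : ℝ) : Vec d :=
  gradient (fun y => L ((x.1, y, x.2.2.1, x.2.2.2), t)) x.2.1

/-- The partial gradient of `L` in its third argument. -/
def partial₃ {d : ℕ} (L : Vec4 d × ℝ → ℝ) (x : Vec4 d) (t : ℝ) : Vec d :=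
  gradient (fun y => L ((x.1, x.2.1, y, x.2.2.2), t)) x.2.2.1

/-- The partial gradient of `L` in its fourth argument. -/
def partial₄ {d : ℕ} (L : Vec4 d × ℝ → ℝ) (x : Vec4 d) (t : ℝ) : Vec d :=
  gradient (fun y => L ((x.1, x.2.1, x.2.2.1, y), t)) x.2.2.2

/-- Regularity of the Lagrangian: integrability of `L` and of its partial gradients along every
element of `W^{1,p}`. -/
structure IsRegular {d : ℕ} (a b : ℝ) (p : ℝ≥0∞) [Fact (1 ≤ p)] (α : ℝ)
    (L : Vec4 d × ℝ → ℝ) : Prop where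
  memLp : ∀ u : Sobolev d a b p,
    MemLp (fun t => L (jet α u t, t)) 1 (intervalMeasure a b)
  memLp₁ : ∀ u : Sobolev d a b p,
    MemLp (fun t => partial₁ L (jet α u t) t) 1 (intervalMeasure a b)
  memLp₂ : ∀ u : Sobolev d a b p,
    MemLp (fun t => partial₂ L (jet α u t) t) p.conjExponent (intervalMeasure a b)
  memLp₃ : ∀ u : Sobolev d a b p,
    MemLp (fun t => partial₃ L (jet α u t) t) p.conjExponent (intervalMeasure a b)
  memLp₄ : ∀ u : Sobolev d a b p,
    MemLp (fun t => partial₄ L (jet α u t) t) p.conjExponent (intervalMeasure a b)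

/-- The fractional variational functional. -/
def functional {d : ℕ} {a b : ℝ} {p : ℝ≥0∞} [Fact (1 ≤ p)] (α : ℝ) (L : Vec4 d × ℝ → ℝ)
    (u : Sobolev d a b p) : ℝ :=
  ∫ t in Ioo a b, L (jet α u t, t)

/-- Coercivity of a functional on a set `E`: it tends to `+∞` as `‖u‖ → ∞` with `u ∈ E`. -/
def IsCoerciveOn {W : Type*} [Norm W] (F : W → ℝ) (E : Set W) : Prop :=
  Tendsto F (comap (fun u => ‖u‖) atTop ⊓ 𝓟 E) atTop

/-- Closedness in the weak topology. -/
def IsWeaklyClosed {W : Type*} [NormedAddCommGroup W] [NormedSpace ℝ W] (E : Set W) : Prop :=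
  IsClosed (toWeakSpace ℝ W '' E)

end FracTonelli

end

/-! The proof is the direct method, with bounded ultrafilters in place of minimizing sequences. Take
an ultrafilter on `E` containing every sublevel set `{F ≤ F v}`, `v ∈ E`. Coercivity puts a ball in
it, so it has a weak limit `x`, and `x ∈ E` by weak closedness. If `F` has a continuous affine
minorant touching it at `x`, then `F x + ℓ (u - x) ≤ F u ≤ F v` along the ultrafilter, and the weak
limit gives `F x ≤ F v`. This is `exists_forall_le_of_subgradient`.

Weak compactness comes from uniform convexity. Nested closed convex sets meeting a fixed ball have
almost-shortest points that form a Cauchy filter, so they share a point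
(`exists_forall_mem_of_isClosed_convex`). Uniform convexity of `W^{1,p}` comes from a pointwise
inequality between `q`-th powers of norms (`UniformlyConvexRpow`), which survives integration, `ℓ^p`
products and passage to subspaces.

The minorant comes from integrating the tangent-plane inequality for `L(·, t)` along jets. Its
linear part is finite because convexity bounds the directional derivative by differences of values
of `L`, which are integrable. It is continuous because truncating the gradient gives bounded
functionals converging to it pointwise, so Banach–Steinhaus applies (`exists_subgradient`). No
Hölder estimate or Sobolev embedding enters: the truncation only needs fractional integration to be
bounded from `L^1` to `L^1`. -/

/-! ### Weak compactness from uniform convexity -/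

/-- In a uniformly convex Banach space, the closed convex members of a filter that contains a
bounded set have a common point. -/
theorem exists_forall_mem_of_isClosed_convex {X : Type*} [NormedAddCommGroup X]
    [NormedSpace ℝ X] [UniformConvexSpace X] [CompleteSpace X] (F : Filter X) [F.NeBot]
    {R : ℝ} (hR : Metric.closedBall (0 : X) R ∈ F) :
    ∃ x : X, ∀ C ∈ F, IsClosed C → Convex ℝ C → x ∈ C := by
  let I : Type _ := {C : Set X // C ∈ F ∧ IsClosed C ∧ Convex ℝ C}
  let i₀ : I := ⟨univ, univ_mem, isClosed_univ, convex_univ⟩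
  have : Nonempty I := ⟨i₀⟩
  let q : I → ℝ := fun C => Metric.infDist 0 C.1
  have hq0 : ∀ C, 0 ≤ q C := fun C => Metric.infDist_nonneg
  have hne : ∀ C : I, C.1.Nonempty := fun C => Filter.nonempty_of_mem C.2.1
  have hbdd : BddAbove (range q) := by
    refine ⟨R, ?_⟩
    rintro _ ⟨C, rfl⟩
    obtain ⟨x, hxC, hxR⟩ := Filter.nonempty_of_mem (inter_mem C.2.1 hR)
    exact (Metric.infDist_le_dist_of_mem hxC).trans (by rwa [dist_comm, ← Metric.mem_closedBall])
  set r : ℝ := ⨆ C, q C with hr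
  have hqr : ∀ C, q C ≤ r := le_ciSup hbdd
  have hr0 : 0 ≤ r := (hq0 i₀).trans (hqr i₀)
  rcases hr0.eq_or_lt with hr0 | hr0
  · refine ⟨0, fun C hC h₁ h₂ => ?_⟩
    have := hqr ⟨C, hC, h₁, h₂⟩
    rw [← hr0] at this
    exact (h₁.mem_iff_infDist_zero (Filter.nonempty_of_mem hC)).2 (le_antisymm this Metric.infDist_nonneg)
  -- Radii strictly above `r` keep every `C ∩ closedBall 0 s` nonempty, since `C` lies at distance
  -- at most `r` from the origin.
  let J : Type _ := I × Ioi r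
  let j₀ : J := (i₀, ⟨r + 1, by simp⟩)
  have : Nonempty J := ⟨j₀⟩
  let S : J → Set X := fun j => j.1.1 ∩ Metric.closedBall 0 j.2
  have hdir : Directed (· ≥ ·) fun j => 𝓟 (S j) := by
    rintro ⟨C, s⟩ ⟨D, t⟩
    refine ⟨(⟨C.1 ∩ D.1, inter_mem C.2.1 D.2.1, C.2.2.1.inter D.2.2.1, C.2.2.2.inter D.2.2.2⟩,
      ⟨min s.1 t.1, mem_Ioi.2 (lt_min (mem_Ioi.1 s.2) (mem_Ioi.1 t.2))⟩), ?_, ?_⟩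
    · exact principal_mono.2 (inter_subset_inter inter_subset_left
        (Metric.closedBall_subset_closedBall (min_le_left _ _)))
    · exact principal_mono.2 (inter_subset_inter inter_subset_right
        (Metric.closedBall_subset_closedBall (min_le_right _ _)))
  have hSne : ∀ j, (S j).Nonempty := by
    rintro ⟨C, s⟩
    obtain ⟨x, hx, hxs⟩ := (Metric.infDist_lt_iff (hne C)).1 ((hqr C).trans_lt s.2)
    exact ⟨x, hx, by rw [Metric.mem_closedBall, dist_comm]; exact hxs.le⟩
  let G : Filter X := ⨅ j, 𝓟 (S j)
  have hG : G.NeBot := iInf_neBot_of_directed hdir fun j => principal_neBot_iff.2 (hSne j)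
  have hSG : ∀ j, S j ∈ G := fun j => mem_iInf_of_mem j (mem_principal_self _)
  have hCau : Cauchy G := by
    rw [Metric.cauchy_iff]
    refine ⟨hG, fun ε hε => ?_⟩
    obtain ⟨δ, hδ, H⟩ := exists_forall_closed_ball_dist_add_le_two_sub X
      (ε := ε / (2 * r)) (by positivity)
    -- This keeps the radius `s` below `2 * r`, matching the scale `ε / (2 * r)`.
    wlog hδ1 : δ ≤ 1 generalizing δ
    · exact this 1 one_pos (fun x hx y hy h => (H hx hy h).trans (by linarith)) le_rfl
    -- Two points of `C` in the ball of radius `r (1 + δ/4)` that are `ε` apart have a midpoint of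
    -- norm at most `r (1 + δ/4)(1 - δ/2) < r - r δ/4`, too short for a point of `C`.
    obtain ⟨C, hC⟩ := exists_lt_of_lt_ciSup (show r - r * δ / 4 < ⨆ C, q C by
      rw [← hr]; nlinarith)
    let s : ℝ := r * (1 + δ / 4)
    have hs : r < s := by simp only [s]; nlinarith
    have hs0 : 0 < s := hr0.trans hs
    refine ⟨_, hSG (C, ⟨s, hs⟩), fun x hx y hy => ?_⟩
    by_contra hxy
    rw [not_lt, dist_eq_norm] at hxy
    have hxs : ‖x‖ ≤ s := by simpa using hx.2
    have hys : ‖y‖ ≤ s := by simpa using hy.2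
    have hscale : ∀ z : X, ‖z‖ ≤ s → ‖s⁻¹ • z‖ ≤ 1 := fun z hz => by
      rwa [norm_smul, norm_inv, Real.norm_of_nonneg hs0.le, inv_mul_le_one₀ hs0]
    have hdist : ε / (2 * r) ≤ ‖s⁻¹ • x - s⁻¹ • y‖ := by
      rw [← smul_sub, norm_smul, norm_inv, Real.norm_of_nonneg hs0.le, div_eq_inv_mul]
      refine mul_le_mul ?_ hxy hε.le (by positivity)
      refine inv_anti₀ hs0 ?_
      simp only [s]
      nlinarith
    have key := H (hscale x hxs) (hscale y hys) hdist
    rw [← smul_add, norm_smul, norm_inv, Real.norm_of_nonneg hs0.le, inv_mul_le_iff₀ hs0] at key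
    have hmid : (1 / 2 : ℝ) • x + (1 / 2 : ℝ) • y ∈ C.1 :=
      C.2.2.2 hx.1 hy.1 (by norm_num) (by norm_num) (by norm_num)
    have h1 := hC.trans_le (Metric.infDist_le_dist_of_mem hmid)
    rw [dist_comm, dist_zero_right, ← smul_add, norm_smul, Real.norm_of_nonneg (by norm_num)] at h1
    simp only [s] at key
    nlinarith [mul_pos hr0 hδ]
  obtain ⟨x, hx⟩ := CompleteSpace.complete hCau
  refine ⟨x, fun C hC h₁ h₂ => ?_⟩
  exact h₁.mem_of_tendsto (b := G) (f := id) hx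
    (mem_of_superset (hSG (⟨C, hC, h₁, h₂⟩, j₀.2)) inter_subset_left)

/-- A bounded ultrafilter on a uniformly convex Banach space has a weak limit. -/
theorem Ultrafilter.exists_tendsto_toWeakSpace {X : Type*} [NormedAddCommGroup X]
    [NormedSpace ℝ X] [UniformConvexSpace X] [CompleteSpace X] (F : Ultrafilter X)
    {R : ℝ} (hR : Metric.closedBall (0 : X) R ∈ F) :
    ∃ x : X, Tendsto (toWeakSpace ℝ X) F (𝓝 (toWeakSpace ℝ X x)) := by
  obtain ⟨x, hx⟩ := exists_forall_mem_of_isClosed_convex (F : Filter X) hR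
  refine ⟨x, ?_⟩
  have hind : IsInducing fun (y : WeakSpace ℝ X) (φ : StrongDual ℝ X) =>
      φ ((toWeakSpace ℝ X).symm y) := ⟨rfl⟩
  rw [hind.tendsto_nhds_iff, tendsto_pi_nhds]
  intro φ
  have hcpt : IsCompact (Metric.closedBall (0 : ℝ) (‖φ‖ * R)) := isCompact_closedBall _ _
  obtain ⟨c, -, hc⟩ := hcpt.ultrafilter_le_nhds (F.map φ) (by
    rw [le_principal_iff]
    change φ ⁻¹' Metric.closedBall 0 (‖φ‖ * R) ∈ (F : Filter X)
    refine mem_of_superset hR fun y hy => ?_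
    rw [mem_preimage, mem_closedBall_zero_iff]
    rw [mem_closedBall_zero_iff] at hy
    exact (φ.le_opNorm y).trans (by gcongr))
  -- Each slab `φ ⁻¹' closedBall c ε` is a closed convex member of `F`, hence contains `x`.
  have hφx : φ x = c := by
    refine eq_of_forall_dist_le fun ε hε => ?_
    exact hx (φ ⁻¹' Metric.closedBall c ε) (hc (Metric.closedBall_mem_nhds c hε))
      (Metric.isClosed_closedBall.preimage φ.continuous)
      ((convex_closedBall c ε).linear_preimage φ.toLinearMap)
  change Tendsto φ F (𝓝 (φ x))
  rwa [hφx]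

/-! ### Uniform convexity through powers of the norm -/

theorem norm_half_smul_add_rpow_le {E : Type*} [NormedAddCommGroup E] [NormedSpace ℝ E]
    {q : ℝ} (hq : 1 ≤ q) (x y : E) :
    ‖(1 / 2 : ℝ) • (x + y)‖ ^ q ≤ (‖x‖ ^ q + ‖y‖ ^ q) / 2 := by
  have h1 : ‖(1 / 2 : ℝ) • (x + y)‖ ≤ (1 / 2 : ℝ) • ‖x‖ + (1 / 2 : ℝ) • ‖y‖ := by
    rw [← smul_add, norm_smul, smul_eq_mul, Real.norm_of_nonneg (by norm_num)]
    gcongr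
    exact norm_add_le _ _
  refine (Real.rpow_le_rpow (norm_nonneg _) h1 (by linarith)).trans ?_
  have := (convexOn_rpow hq).2 (norm_nonneg x) (norm_nonneg y)
    (show (0 : ℝ) ≤ 1 / 2 by norm_num) (show (0 : ℝ) ≤ 1 / 2 by norm_num) (by norm_num)
  refine this.trans_eq ?_
  simp only [smul_eq_mul]
  ring

/-- Strict midpoint convexity of `‖·‖ ^ q` for `1 < q` in a strictly convex space. -/
theorem norm_half_smul_add_rpow_lt {E : Type*} [NormedAddCommGroup E] [NormedSpace ℝ E]
    [StrictConvexSpace ℝ E] {q : ℝ} (hq : 1 < q) {x y : E} (hxy : x ≠ y) :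
    ‖(1 / 2 : ℝ) • (x + y)‖ ^ q < (‖x‖ ^ q + ‖y‖ ^ q) / 2 := by
  -- Equal norms use strict convexity of the space; different norms use strict convexity of `t ↦ t ^
  -- q`.
  by_cases h : ‖x‖ = ‖y‖
  · rw [← h, add_self_div_two]
    exact Real.rpow_lt_rpow (norm_nonneg _) ((norm_midpoint_lt_iff h).2 hxy) (by linarith)
  · have h1 : ‖(1 / 2 : ℝ) • (x + y)‖ ≤ (1 / 2 : ℝ) • ‖x‖ + (1 / 2 : ℝ) • ‖y‖ := by
      rw [← smul_add, norm_smul, smul_eq_mul, Real.norm_of_nonneg (by norm_num)]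
      gcongr
      exact norm_add_le _ _
    refine (Real.rpow_le_rpow (norm_nonneg _) h1 (by linarith)).trans_lt ?_
    have := (strictConvexOn_rpow hq).2 (norm_nonneg x) (norm_nonneg y) h
      (show (0 : ℝ) < 1 / 2 by norm_num) (show (0 : ℝ) < 1 / 2 by norm_num) (by norm_num)
    refine this.trans_eq ?_
    simp only [smul_eq_mul]
    ring

/-- The property of `‖·‖ ^ q` that quantifies its uniform convexity and passes to `L^q` spaces
by integration. -/
def UniformlyConvexRpow (E : Type*) [NormedAddCommGroup E] [NormedSpace ℝ E] (q : ℝ) : Prop :=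
  ∀ ε > 0, ∃ c > 0, ∀ x y : E, ‖x - y‖ ^ q ≤ ε * (‖x‖ ^ q + ‖y‖ ^ q) +
    c * ((‖x‖ ^ q + ‖y‖ ^ q) / 2 - ‖(1 / 2 : ℝ) • (x + y)‖ ^ q)

/-- By homogeneity it suffices to treat `‖x‖ ^ q + ‖y‖ ^ q = 1`. The pairs with `‖x - y‖ ^ q ≥ ε`
then form a compact set on which the convexity defect is positive, so it has a minimum `m > 0`. As
`‖x - y‖ ≤ 2` there, the constant `2 ^ q / m` works. -/
theorem UniformlyConvexRpow.of_properSpace (E : Type*) [NormedAddCommGroup E] [NormedSpace ℝ E]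
    [StrictConvexSpace ℝ E] [ProperSpace E] {q : ℝ} (hq : 1 < q) : UniformlyConvexRpow E q := by
  intro ε hε
  have hq0 : 0 < q := by linarith
  have hcont : ∀ {f : E × E → E}, Continuous f → Continuous fun z => ‖f z‖ ^ q := fun hf =>
    hf.norm.rpow_const fun _ => Or.inr hq0.le
  let K : Set (E × E) := {z | ‖z.1‖ ^ q + ‖z.2‖ ^ q = 1 ∧ ε ≤ ‖z.1 - z.2‖ ^ q}
  let φ : E × E → ℝ := fun z => (‖z.1‖ ^ q + ‖z.2‖ ^ q) / 2 - ‖(1 / 2 : ℝ) • (z.1 + z.2)‖ ^ q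
  have hφ : Continuous φ :=
    (((hcont continuous_fst).add (hcont continuous_snd)).div_const 2).sub
      (hcont ((continuous_fst.add continuous_snd).const_smul (1 / 2 : ℝ)))
  have hle1 : ∀ s t : ℝ, 0 ≤ s → 0 ≤ t → s ^ q + t ^ q = 1 → s ≤ 1 := fun s t hs ht h => by
    by_contra! h1
    linarith [Real.rpow_nonneg ht q, Real.one_lt_rpow h1 hq0]
  have hKc : IsCompact K := by
    refine Metric.isCompact_of_isClosed_isBounded ?_ ?_
    · exact (isClosed_eq ((hcont continuous_fst).add (hcont continuous_snd))
        continuous_const).inter (isClosed_le continuous_const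
          (hcont (continuous_fst.sub continuous_snd)))
    · refine (Metric.isBounded_closedBall (x := (0 : E × E)) (r := 1)).subset fun z hz => ?_
      rw [mem_closedBall_zero_iff]
      refine max_le (hle1 _ _ (norm_nonneg _) (norm_nonneg _) hz.1)
        (hle1 _ _ (norm_nonneg _) (norm_nonneg _) ((add_comm _ _).trans hz.1))
  have hφ0 : ∀ z, 0 ≤ φ z := fun z => sub_nonneg.2 (norm_half_smul_add_rpow_le hq.le _ _)
  obtain ⟨m, hm, hmK⟩ : ∃ m > 0, ∀ z ∈ K, m ≤ φ z := by
    rcases K.eq_empty_or_nonempty with h | h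
    · exact ⟨1, one_pos, by simp [h]⟩
    · obtain ⟨z, hz, hmin⟩ := hKc.exists_isMinOn h hφ.continuousOn
      refine ⟨φ z, sub_pos.2 (norm_half_smul_add_rpow_lt hq fun h0 => ?_), hmin⟩
      have := hz.2
      rw [h0, sub_self, norm_zero, Real.zero_rpow hq0.ne'] at this
      linarith
  have key : ∀ x y : E, ‖x‖ ^ q + ‖y‖ ^ q = 1 → ‖x - y‖ ^ q ≤ ε + 2 ^ q / m * φ (x, y) := by
    intro x y hxy
    have h0 : 0 ≤ 2 ^ q / m * φ (x, y) := mul_nonneg (by positivity) (hφ0 _)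
    by_cases h : ε ≤ ‖x - y‖ ^ q
    · have h1 : ‖x - y‖ ≤ 2 := by
        linarith [norm_sub_le x y, hle1 _ _ (norm_nonneg _) (norm_nonneg _) hxy,
          hle1 _ _ (norm_nonneg _) (norm_nonneg _) ((add_comm _ _).trans hxy)]
      have h2 : ‖x - y‖ ^ q ≤ 2 ^ q := Real.rpow_le_rpow (norm_nonneg _) h1 hq0.le
      have h3 : 2 ^ q / m * m ≤ 2 ^ q / m * φ (x, y) :=
        mul_le_mul_of_nonneg_left (hmK (x, y) ⟨hxy, h⟩) (by positivity)
      rw [div_mul_cancel₀ _ hm.ne'] at h3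
      linarith
    · linarith
  refine ⟨2 ^ q / m, by positivity, fun x y => ?_⟩
  set S := ‖x‖ ^ q + ‖y‖ ^ q with hS
  have hx0 := Real.rpow_nonneg (norm_nonneg x) q
  have hy0 := Real.rpow_nonneg (norm_nonneg y) q
  have hS0 : 0 ≤ S := add_nonneg hx0 hy0
  rcases hS0.eq_or_lt with h | h
  · have hx : x = 0 := norm_eq_zero.1 <|
      (Real.rpow_eq_zero (norm_nonneg x) hq0.ne').1 (by linarith)
    have hy : y = 0 := norm_eq_zero.1 <|
      (Real.rpow_eq_zero (norm_nonneg y) hq0.ne').1 (by linarith)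
    rw [← h]
    simp [hx, hy, Real.zero_rpow hq0.ne']
  -- This factor normalizes the pair, as `s ^ q = S⁻¹`.
  · set s : ℝ := (S ^ q⁻¹)⁻¹ with hs
    have hs0 : 0 < s := inv_pos.2 (Real.rpow_pos_of_pos h _)
    have hsq : s ^ q = S⁻¹ := by
      rw [hs, Real.inv_rpow (by positivity), Real.rpow_inv_rpow hS0 hq0.ne']
    have hscale : ∀ z : E, ‖s • z‖ ^ q = S⁻¹ * ‖z‖ ^ q := fun z => by
      rw [norm_smul, Real.norm_of_nonneg hs0.le, Real.mul_rpow hs0.le (norm_nonneg _), hsq]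
    have := key (s • x) (s • y) (by
      rw [hscale, hscale, ← mul_add, ← hS, inv_mul_cancel₀ h.ne'])
    simp only [φ] at this
    rw [← smul_sub, ← smul_add, smul_comm, hscale, hscale, hscale, hscale, ← mul_add, ← hS] at this
    have h2 := mul_le_mul_of_nonneg_left this hS0
    rw [mul_inv_cancel_left₀ h.ne'] at h2
    refine h2.trans_eq ?_
    field_simp

theorem UniformlyConvexRpow.uniformConvexSpace {E : Type*} [NormedAddCommGroup E]
    [NormedSpace ℝ E] {q : ℝ} (hq : 1 < q) (h : UniformlyConvexRpow E q) :
    UniformConvexSpace E := by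
  refine ⟨fun η hη => ?_⟩
  have hq0 : 0 < q := by linarith
  have hηq : 0 < η ^ q := Real.rpow_pos_of_pos hη q
  -- For unit vectors the `ε` term is then `η ^ q / 2`, absorbed by the left side; Bernoulli's
  -- inequality turns the remaining defect `1 - m ^ q` into `q (1 - m)`.
  obtain ⟨c, hc, H⟩ := h (η ^ q / 4) (by positivity)
  refine ⟨η ^ q / (q * c), by positivity, fun x hx y hy hxy => ?_⟩
  have h1 := H x y
  have h2 : η ^ q ≤ ‖x - y‖ ^ q := Real.rpow_le_rpow hη.le hxy hq0.le
  rw [hx, hy, Real.one_rpow] at h1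
  have hm : ‖(1 / 2 : ℝ) • (x + y)‖ = ‖x + y‖ / 2 := by
    rw [norm_smul, Real.norm_of_nonneg (by norm_num)]
    ring
  rw [hm] at h1
  set m := ‖x + y‖ / 2 with hmdef
  have hm0 : 0 ≤ m := by positivity
  have hB : 1 + q * (m - 1) ≤ m ^ q := by
    have := one_add_mul_self_le_rpow_one_add (s := m - 1) (by linarith) hq.le
    rwa [add_sub_cancel] at this
  have h3 : η ^ q / 2 ≤ c * (q * (1 - m)) :=
    calc η ^ q / 2 ≤ c * (1 - m ^ q) := by linarith
      _ ≤ c * (q * (1 - m)) := by gcongr; linarith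
  have h4 : η ^ q / (q * c) ≤ 2 * (1 - m) := by
    rw [div_le_iff₀ (by positivity)]
    linarith
  linarith

theorem MeasureTheory.Lp.norm_rpow_eq_integral {α E : Type*} [MeasurableSpace α] {μ : Measure α}
    [NormedAddCommGroup E] {p : ℝ≥0∞} (hp₀ : p ≠ 0) (hp : p ≠ ⊤) (f : Lp E p μ) :
    ‖f‖ ^ p.toReal = ∫ x, ‖f x‖ ^ p.toReal ∂μ := by
  have h0 : 0 < p.toReal := ENNReal.toReal_pos hp₀ hp
  have hnn : 0 ≤ ∫ x, ‖f x‖ ^ p.toReal ∂μ := integral_nonneg fun x => by positivity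
  rw [Lp.norm_def, (Lp.memLp f).eLpNorm_eq_integral_rpow_norm hp₀ hp,
    ENNReal.toReal_ofReal (by positivity), Real.rpow_inv_rpow hnn h0.ne']

/-- With exponent `p` itself, every term of the inequality is an integral of its pointwise
counterpart, so the constants are unchanged. -/
theorem UniformlyConvexRpow.lp {α E : Type*} [MeasurableSpace α] (μ : Measure α)
    [NormedAddCommGroup E] [NormedSpace ℝ E] {p : ℝ≥0∞} [Fact (1 ≤ p)] (hp : p ≠ ⊤)
    (h : UniformlyConvexRpow E p.toReal) : UniformlyConvexRpow (Lp E p μ) p.toReal := by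
  have hp₀ : p ≠ 0 := (one_pos.trans_le (Fact.out : 1 ≤ p)).ne'
  intro ε hε
  obtain ⟨c, hc, H⟩ := h ε hε
  refine ⟨c, hc, fun f g => ?_⟩
  have hint : ∀ u : Lp E p μ, Integrable (fun x => ‖u x‖ ^ p.toReal) μ := fun u =>
    (Lp.memLp u).integrable_norm_rpow hp₀ hp
  simp only [Lp.norm_rpow_eq_integral hp₀ hp]
  have hS : Integrable (fun x => ‖f x‖ ^ p.toReal + ‖g x‖ ^ p.toReal) μ := (hint f).add (hint g)
  have hD : Integrable (fun x => (‖f x‖ ^ p.toReal + ‖g x‖ ^ p.toReal) / 2 -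
      ‖((1 / 2 : ℝ) • (f + g) : Lp E p μ) x‖ ^ p.toReal) μ := (hS.div_const 2).sub (hint _)
  rw [← integral_add (hint f) (hint g), ← integral_const_mul, ← integral_div,
    ← integral_sub (hS.div_const 2) (hint _), ← integral_const_mul,
    ← integral_add (hS.const_mul ε) (hD.const_mul c)]
  refine integral_mono_ae (hint _) ((hS.const_mul ε).add (hD.const_mul c)) ?_
  filter_upwards [Lp.coeFn_sub f g, Lp.coeFn_add f g, Lp.coeFn_smul (1 / 2 : ℝ) (f + g)]
    with x h1 h2 h3
  rw [h1, h3, Pi.smul_apply, h2]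
  exact H (f x) (g x)

theorem UniformlyConvexRpow.prod {E F : Type*} [NormedAddCommGroup E] [NormedSpace ℝ E]
    [NormedAddCommGroup F] [NormedSpace ℝ F] {p : ℝ≥0∞} [Fact (1 ≤ p)] (hp : p ≠ ⊤)
    (hE : UniformlyConvexRpow E p.toReal) (hF : UniformlyConvexRpow F p.toReal) :
    UniformlyConvexRpow (WithLp p (E × F)) p.toReal := by
  have h0 : 0 < p.toReal := ENNReal.toReal_pos (one_pos.trans_le (Fact.out : 1 ≤ p)).ne' hp
  have hn : ∀ w : WithLp p (E × F),
      ‖w‖ ^ p.toReal = ‖w.fst‖ ^ p.toReal + ‖w.snd‖ ^ p.toReal := fun w => by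
    rw [WithLp.prod_norm_eq_add h0, one_div, Real.rpow_inv_rpow (by positivity) h0.ne']
  have hp1 : 1 ≤ p.toReal := by
    simpa using ENNReal.toReal_mono hp (Fact.out : 1 ≤ p)
  intro ε hε
  obtain ⟨c, hc, H⟩ := hE ε hε
  obtain ⟨c', hc', H'⟩ := hF ε hε
  -- Enlarging each constant is harmless because both convexity defects are nonnegative.
  refine ⟨max c c', lt_max_of_lt_left hc, fun x y => ?_⟩
  have h1 := H x.fst y.fst
  have h2 := H' x.snd y.snd
  have h3 := mul_le_mul_of_nonneg_right (le_max_left c c') (sub_nonneg.2 (norm_half_smul_add_rpow_le hp1 x.fst y.fst))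
  have h4 := mul_le_mul_of_nonneg_right (le_max_right c c') (sub_nonneg.2 (norm_half_smul_add_rpow_le hp1 x.snd y.snd))
  simp only [hn, WithLp.sub_fst, WithLp.sub_snd, WithLp.smul_fst, WithLp.smul_snd,
    WithLp.add_fst, WithLp.add_snd]
  linarith

theorem UniformlyConvexRpow.submodule {E : Type*} [NormedAddCommGroup E] [NormedSpace ℝ E] {q : ℝ}
    (h : UniformlyConvexRpow E q) (V : Submodule ℝ E) : UniformlyConvexRpow V q := by
  intro ε hε
  obtain ⟨c, hc, H⟩ := h ε hε
  exact ⟨c, hc, fun x y => H x y⟩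

/-! ### Uniform convexity and completeness of `W^{1,p}` -/

namespace FracTonelli

theorem uniformConvexSpace_sobolev {d : ℕ} {a b : ℝ} {p : ℝ≥0∞} [Fact (1 ≤ p)] (hp₁ : 1 < p)
    (hp : p ≠ ⊤) : UniformConvexSpace (Sobolev d a b p) := by
  have hq : 1 < p.toReal := by
    simpa using (ENNReal.toReal_lt_toReal (by simp) hp).2 hp₁
  have h := (UniformlyConvexRpow.of_properSpace (Vec d) hq).lp (intervalMeasure a b) hp
  exact ((h.prod hp h).submodule (Sobolev d a b p)).uniformConvexSpace hq

theorem integral_norm_Lp_le {d : ℕ} {a b : ℝ} {p : ℝ≥0∞} [hp : Fact (1 ≤ p)]  :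
    ∃ C : ℝ, 0 ≤ C ∧ ∀ f : LpSpace d a b p, ∫ t in Ioo a b, ‖f t‖ ≤ C * ‖f‖ := by
  refine ⟨((intervalMeasure a b) univ ^ (1 - 1 / p.toReal)).toReal, ENNReal.toReal_nonneg,
    fun f => ?_⟩
  have h := eLpNorm_le_eLpNorm_mul_rpow_measure_univ hp.out (Lp.aestronglyMeasurable f)
  rw [Lp.norm_def, integral_norm_eq_lintegral_enorm (Lp.aestronglyMeasurable f),
    ← eLpNorm_one_eq_lintegral_enorm, ← ENNReal.toReal_mul, mul_comm]
  refine ENNReal.toReal_mono (ENNReal.mul_ne_top (Lp.memLp f).eLpNorm_ne_top ?_) (by simpa using h)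
  refine ENNReal.rpow_ne_top_of_nonneg ?_ (measure_ne_top _ _)
  rcases eq_or_ne p ⊤ with rfl | h
  · simp
  · have : 1 ≤ p.toReal := by simpa using ENNReal.toReal_mono h hp.out
    rw [sub_nonneg, div_le_one (by linarith)]
    exact this

theorem continuous_integral_smul_Lp {d : ℕ} {a b : ℝ} {p : ℝ≥0∞} [Fact (1 ≤ p)] {ψ : ℝ → ℝ}
    (hc : Continuous ψ) (hs : HasCompactSupport ψ) :
    Continuous fun f : LpSpace d a b p => ∫ t in Ioo a b, ψ t • f t := by
  obtain ⟨M, hM⟩ := hs.exists_bound_of_continuous hc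
  have hM0 : 0 ≤ M := (norm_nonneg _).trans (hM 0)
  obtain ⟨C, hC0, hC⟩ := integral_norm_Lp_le (d := d) (a := a) (b := b) (p := p)
  refine (LipschitzWith.of_dist_le_mul (K := ⟨M * C, by positivity⟩) fun f g => ?_).continuous
  rw [dist_eq_norm, dist_eq_norm, ← integral_sub (integrable_smul_Lp hc hs f)
    (integrable_smul_Lp hc hs g)]
  have hfg : ∫ t in Ioo a b, (ψ t • f t - ψ t • g t) =
      ∫ t in Ioo a b, ψ t • (f - g : LpSpace d a b p) t := by
    refine integral_congr_ae ?_
    filter_upwards [Lp.coeFn_sub f g] with t ht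
    rw [ht, Pi.sub_apply, smul_sub]
  rw [hfg]
  calc ‖∫ t in Ioo a b, ψ t • (f - g : LpSpace d a b p) t‖
      ≤ ∫ t in Ioo a b, M * ‖(f - g : LpSpace d a b p) t‖ := by
        refine norm_integral_le_of_norm_le
          ((((Lp.memLp (f - g)).integrable Fact.out).norm).const_mul M) (ae_of_all _ fun t => ?_)
        rw [norm_smul]
        gcongr
        exact hM t
    _ = M * ∫ t in Ioo a b, ‖(f - g : LpSpace d a b p) t‖ := integral_const_mul _ _
    _ ≤ M * (C * ‖f - g‖) := by gcongr; exact hC _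
    _ = M * C * ‖f - g‖ := by ring

/-- For each test function, both sides of the weak-derivative identity are continuous on `L^p ×
L^p`. -/
theorem isClosed_sobolev {d : ℕ} {a b : ℝ} {p : ℝ≥0∞} [Fact (1 ≤ p)] :
    IsClosed (Sobolev d a b p : Set (WithLp p (LpSpace d a b p × LpSpace d a b p))) := by
  change IsClosed {w : WithLp p (LpSpace d a b p × LpSpace d a b p) |
    ∀ φ : ℝ → ℝ, IsTestFunction a b φ →
      ∫ t in Ioo a b, deriv φ t • w.fst t = -∫ t in Ioo a b, φ t • w.snd t}
  simp only [ofPred_forall]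
  refine isClosed_iInter fun φ => isClosed_iInter fun hφ => isClosed_eq ?_ ?_
  · exact (continuous_integral_smul_Lp (hφ.contDiff.continuous_deriv (by simp))
      hφ.hasCompactSupport.deriv).comp (WithLp.prod_continuous_ofLp p _ _).fst
  · exact ((continuous_integral_smul_Lp hφ.contDiff.continuous hφ.hasCompactSupport).comp
      (WithLp.prod_continuous_ofLp p _ _).snd).neg

theorem completeSpace_sobolev {d : ℕ} {a b : ℝ} {p : ℝ≥0∞} [Fact (1 ≤ p)] :
    CompleteSpace (Sobolev d a b p) :=
  isClosed_sobolev.completeSpace_coe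

end FracTonelli

/-! ### Fractional integrals and jets in `L^1` -/

namespace FracTonelli

open scoped Convolution

/-- The singular kernel of the fractional integral, truncated to `(0, l)`. -/
noncomputable def rlKernel (β l : ℝ) : ℝ → ℝ := (Ioo 0 l).indicator fun s => (s ^ (1 - β))⁻¹

theorem rlKernel_nonneg (β l s : ℝ) : 0 ≤ rlKernel β l s :=
  indicator_nonneg (fun _ hs => inv_nonneg.2 (Real.rpow_nonneg hs.1.le _)) s

theorem integrable_rlKernel {β : ℝ} (hβ : 0 < β) (l : ℝ) : Integrable (rlKernel β l) := by
  refine (integrable_indicator_iff measurableSet_Ioo).2 ?_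
  rcases le_or_gt l 0 with hl | hl
  · simp [Ioo_eq_empty (not_lt.2 hl)]
  have h := (intervalIntegral.integrableOn_Ioo_rpow_iff (s := β - 1) hl).2 (by linarith)
  refine h.congr_fun (fun s hs => ?_) measurableSet_Ioo
  change s ^ (β - 1) = (s ^ (1 - β))⁻¹
  rw [← Real.rpow_neg hs.1.le, neg_sub]

/-- Reversed scalar multiplication, as used to write the fractional integral as a convolution. -/
noncomputable abbrev rlPairing (d : ℕ) : Vec d →L[ℝ] ℝ →L[ℝ] Vec d :=
  (ContinuousLinearMap.lsmul ℝ ℝ : ℝ →L[ℝ] Vec d →L[ℝ] Vec d).flip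

/-- For `t` and `y` in `(a, b)` the difference `t - y` is below `b - a`, so truncating the kernel
there loses nothing and makes it integrable on the line. -/
theorem leftRL_eq_convolution {d : ℕ} {a b β t : ℝ} (f : ℝ → Vec d) (ht : t ∈ Ioo a b) :
    leftRL a β f t = (Real.Gamma β)⁻¹ •
      ((Ioo a b).indicator f ⋆[rlPairing d] rlKernel β (b - a)) t := by
  rw [leftRL, convolution, intervalIntegral.integral_of_le ht.1.le, integral_Ioc_eq_integral_Ioo,
    ← integral_indicator measurableSet_Ioo]
  congr 2
  ext1 y
  simp only [ContinuousLinearMap.flip_apply, ContinuousLinearMap.lsmul_apply]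
  by_cases hy : y ∈ Ioo a t
  · have h1 : y ∈ Ioo a b := ⟨hy.1, hy.2.trans ht.2⟩
    have h2 : t - y ∈ Ioo 0 (b - a) := ⟨sub_pos.2 hy.2, by linarith [hy.1, ht.2]⟩
    rw [indicator_of_mem hy, indicator_of_mem h1, rlKernel, indicator_of_mem h2]
  · rw [indicator_of_notMem hy]
    by_cases h1 : y ∈ Ioo a b
    · have h2 : t - y ∉ Ioo 0 (b - a) := fun h => hy ⟨h1.1, sub_pos.1 h.1⟩
      rw [rlKernel, indicator_of_notMem h2, zero_smul]
    · rw [indicator_of_notMem h1, smul_zero]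

/-- Only almost everywhere: the singular integrals of `L^1` functions need not converge at every
`t`. -/
theorem leftRL_add_smul {d : ℕ} {a b β : ℝ} (hβ : 0 < β) {f g h : ℝ → Vec d} (r : ℝ)
    (hf : Integrable f (intervalMeasure a b)) (hg : Integrable g (intervalMeasure a b))
    (hh : h =ᵐ[intervalMeasure a b] fun t => f t + r • g t) :
    leftRL a β h =ᵐ[intervalMeasure a b] fun t => leftRL a β f t + r • leftRL a β g t := by
  have hk := integrable_rlKernel hβ (b - a)
  have hf' := (integrable_indicator_iff measurableSet_Ioo).2 hf
  have hg' := (integrable_indicator_iff measurableSet_Ioo).2 hg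
  have hh' : (Ioo a b).indicator h =ᵐ[volume]
      fun t => (Ioo a b).indicator f t + r • (Ioo a b).indicator g t := by
    filter_upwards [(ae_restrict_iff' measurableSet_Ioo).1 hh] with t ht
    by_cases hm : t ∈ Ioo a b
    · simp only [indicator_of_mem hm]
      exact ht hm
    · simp [indicator_of_notMem hm]
  filter_upwards [ae_restrict_of_ae (hf'.ae_convolution_exists (rlPairing d) hk),
    ae_restrict_of_ae (hg'.ae_convolution_exists (rlPairing d) hk),
    ae_restrict_mem measurableSet_Ioo] with t h1 h2 ht
  rw [leftRL_eq_convolution f ht, leftRL_eq_convolution g ht, leftRL_eq_convolution h ht,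
    smul_comm r, ← smul_add]
  congr 1
  simp only [convolution]
  have h3 : Integrable fun y => r • rlPairing d ((Ioo a b).indicator g y)
      (rlKernel β (b - a) (t - y)) := h2.smul r
  rw [← integral_smul, ← integral_add h1 h3]
  refine integral_congr_ae ?_
  filter_upwards [hh'] with y hy
  rw [hy]
  simp [smul_comm r]

theorem integrable_leftRL {d : ℕ} {a b β : ℝ} (hβ : 0 < β) {f : ℝ → Vec d}
    (hf : Integrable f (intervalMeasure a b)) :
    Integrable (leftRL a β f) (intervalMeasure a b) := by
  have hf' := (integrable_indicator_iff measurableSet_Ioo).2 hf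
  have h := ((hf'.integrable_convolution (rlPairing d)
    (integrable_rlKernel hβ (b - a))).smul (Real.Gamma β)⁻¹).restrict (s := Ioo a b)
  refine h.congr ?_
  filter_upwards [ae_restrict_mem measurableSet_Ioo] with t ht
  exact (leftRL_eq_convolution f ht).symm

/-- Young's inequality in `L^1`: dominate by the convolution of `‖f‖` with the kernel, extend the
integral to the whole line, and use that the integral of a convolution is the product of the
integrals. -/
theorem integral_norm_leftRL_le {d : ℕ} {a b β : ℝ} (hβ : 0 < β) {f : ℝ → Vec d}
    (hf : Integrable f (intervalMeasure a b)) :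
    ∫ t in Ioo a b, ‖leftRL a β f t‖ ≤
      ‖(Real.Gamma β)⁻¹‖ * (∫ s, rlKernel β (b - a) s) * ∫ t in Ioo a b, ‖f t‖ := by
  have hk := integrable_rlKernel hβ (b - a)
  have hf' := (integrable_indicator_iff measurableSet_Ioo).2 hf
  set k := rlKernel β (b - a) with hkdef
  set F : ℝ → ℝ := fun t => ‖(Ioo a b).indicator f t‖ with hF
  have hFi : Integrable F := hf'.norm
  have hconv : Integrable (F ⋆[ContinuousLinearMap.mul ℝ ℝ] k) :=
    hFi.integrable_convolution _ hk
  have hnn : ∀ t, 0 ≤ (F ⋆[ContinuousLinearMap.mul ℝ ℝ] k) t := fun t =>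
    integral_nonneg fun y => mul_nonneg (norm_nonneg _) (rlKernel_nonneg _ _ _)
  have hle : ∀ t ∈ Ioo a b, ‖leftRL a β f t‖ ≤
      ‖(Real.Gamma β)⁻¹‖ * (F ⋆[ContinuousLinearMap.mul ℝ ℝ] k) t := fun t ht => by
    rw [leftRL_eq_convolution f ht, norm_smul]
    gcongr
    refine (norm_integral_le_integral_norm _).trans_eq (integral_congr_ae (ae_of_all _ fun y => ?_))
    simp only [ContinuousLinearMap.flip_apply, ContinuousLinearMap.lsmul_apply, norm_smul,
      ContinuousLinearMap.mul_apply', hF]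
    rw [Real.norm_of_nonneg (rlKernel_nonneg _ _ _), mul_comm]
  calc ∫ t in Ioo a b, ‖leftRL a β f t‖
      ≤ ∫ t in Ioo a b, ‖(Real.Gamma β)⁻¹‖ * (F ⋆[ContinuousLinearMap.mul ℝ ℝ] k) t :=
        setIntegral_mono_on (integrable_leftRL hβ hf).norm
          (hconv.const_mul _).integrableOn measurableSet_Ioo hle
    _ = ‖(Real.Gamma β)⁻¹‖ * ∫ t in Ioo a b, (F ⋆[ContinuousLinearMap.mul ℝ ℝ] k) t :=
        integral_const_mul _ _
    _ ≤ ‖(Real.Gamma β)⁻¹‖ * ∫ t, (F ⋆[ContinuousLinearMap.mul ℝ ℝ] k) t := by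
        exact mul_le_mul_of_nonneg_left (setIntegral_le_integral hconv (ae_of_all _ hnn))
          (norm_nonneg _)
    _ = _ := by
        rw [integral_convolution _ hFi hk, ContinuousLinearMap.mul_apply', hF]
        simp only [norm_indicator_eq_indicator_norm]
        rw [integral_indicator measurableSet_Ioo]
        ring

section Jet

variable {d : ℕ} {a b : ℝ} {p : ℝ≥0∞} [Fact (1 ≤ p)]

theorem integrable_fn (u : Sobolev d a b p) : Integrable (Sobolev.fn u) (intervalMeasure a b) :=
  (Lp.memLp u.1.fst).integrable Fact.out

theorem integrable_dot (u : Sobolev d a b p) : Integrable (Sobolev.dot u) (intervalMeasure a b) :=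
  (Lp.memLp u.1.snd).integrable Fact.out

theorem fn_add_smul (u w : Sobolev d a b p) (r : ℝ) :
    Sobolev.fn (u + r • w) =ᵐ[intervalMeasure a b]
      fun t => Sobolev.fn u t + r • Sobolev.fn w t := by
  filter_upwards [Lp.coeFn_add u.1.fst (r • w.1.fst), Lp.coeFn_smul r w.1.fst] with t h1 h2
  rw [Pi.add_apply, h2] at h1
  exact h1

theorem dot_add_smul (u w : Sobolev d a b p) (r : ℝ) :
    Sobolev.dot (u + r • w) =ᵐ[intervalMeasure a b]
      fun t => Sobolev.dot u t + r • Sobolev.dot w t := by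
  filter_upwards [Lp.coeFn_add u.1.snd (r • w.1.snd), Lp.coeFn_smul r w.1.snd] with t h1 h2
  rw [Pi.add_apply, h2] at h1
  exact h1

variable {α : ℝ}

theorem jet_add_smul (hα₀ : 0 < α) (hα₁ : α < 1) (u w : Sobolev d a b p) (r : ℝ) :
    jet α (u + r • w) =ᵐ[intervalMeasure a b] fun t => jet α u t + r • jet α w t := by
  filter_upwards [fn_add_smul u w r, dot_add_smul u w r,
    leftRL_add_smul hα₀ r (integrable_fn u) (integrable_fn w) (fn_add_smul u w r),
    leftRL_add_smul (sub_pos.2 hα₁) r (integrable_dot u) (integrable_dot w) (dot_add_smul u w r)]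
    with t h1 h2 h3 h4
  simp only [jet, leftCaputo, h1, h2, h3, h4, Prod.smul_mk, Prod.mk_add_mk]

theorem integrable_jet (hα₀ : 0 < α) (hα₁ : α < 1) (u : Sobolev d a b p) :
    Integrable (jet α u) (intervalMeasure a b) :=
  (integrable_fn u).prodMk ((integrable_leftRL hα₀ (integrable_fn u)).prodMk
    ((integrable_dot u).prodMk (integrable_leftRL (sub_pos.2 hα₁) (integrable_dot u))))

theorem integral_norm_jet_le (hα₀ : 0 < α) (hα₁ : α < 1) :
    ∃ C : ℝ, 0 ≤ C ∧ ∀ u : Sobolev d a b p, ∫ t in Ioo a b, ‖jet α u t‖ ≤ C * ‖u‖ := by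
  obtain ⟨C, hC0, hC⟩ := integral_norm_Lp_le (d := d) (a := a) (b := b) (p := p)
  set c : ℝ → ℝ := fun β => ‖(Real.Gamma β)⁻¹‖ * (∫ s, rlKernel β (b - a) s) with hc
  have hc0 : ∀ β, 0 ≤ c β := fun β =>
    mul_nonneg (norm_nonneg _) (integral_nonneg fun s => rlKernel_nonneg _ _ _)
  have h1 := hc0 α
  have h2 := hc0 (1 - α)
  refine ⟨C + c α * C + C + c (1 - α) * C, by positivity, fun u => ?_⟩
  have hfn : ∫ t in Ioo a b, ‖Sobolev.fn u t‖ ≤ C * ‖u‖ :=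
    (hC _).trans (mul_le_mul_of_nonneg_left (WithLp.norm_fst_le _ _) hC0)
  have hdot : ∫ t in Ioo a b, ‖Sobolev.dot u t‖ ≤ C * ‖u‖ :=
    (hC _).trans (mul_le_mul_of_nonneg_left (WithLp.norm_snd_le _ _) hC0)
  have i1 := integrable_fn u
  have i2 := integrable_leftRL hα₀ i1
  have i3 := integrable_dot u
  have i4 := integrable_leftRL (sub_pos.2 hα₁) i3
  have hrl := (integral_norm_leftRL_le hα₀ i1).trans (mul_le_mul_of_nonneg_left hfn h1)
  have hca := (integral_norm_leftRL_le (sub_pos.2 hα₁) i3).trans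
    (mul_le_mul_of_nonneg_left hdot h2)
  have hsum : ∫ t in Ioo a b, ‖jet α u t‖ ≤ (∫ t in Ioo a b, ‖Sobolev.fn u t‖) +
      ((∫ t in Ioo a b, ‖leftRL a α (Sobolev.fn u) t‖) + ((∫ t in Ioo a b, ‖Sobolev.dot u t‖) +
        ∫ t in Ioo a b, ‖leftRL a (1 - α) (Sobolev.dot u) t‖)) := by
    have j3 : Integrable (fun t => ‖Sobolev.dot u t‖ + ‖leftRL a (1 - α) (Sobolev.dot u) t‖)
        (intervalMeasure a b) := i3.norm.add i4.norm
    have j2 : Integrable (fun t => ‖leftRL a α (Sobolev.fn u) t‖ + (‖Sobolev.dot u t‖ +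
        ‖leftRL a (1 - α) (Sobolev.dot u) t‖)) (intervalMeasure a b) := i2.norm.add j3
    have j1 := i1.norm.add j2
    rw [← integral_add i3.norm i4.norm, ← integral_add i2.norm j3, ← integral_add i1.norm j2]
    refine integral_mono (integrable_jet hα₀ hα₁ u).norm j1 fun t => ?_
    -- The norm on `Vec4 d` is a nested maximum, here bounded by the sum.
    have hmax : ∀ {s t s' t' : ℝ}, 0 ≤ s → 0 ≤ t' → s ≤ s' → t ≤ t' → 0 ≤ s' →
        max s t ≤ s' + t' := fun h h' h1 h2 h3 => max_le (by linarith) (by linarith)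
    exact hmax (norm_nonneg _) (by positivity) le_rfl
      (hmax (norm_nonneg _) (by positivity) le_rfl
        (hmax (norm_nonneg _) (norm_nonneg _) le_rfl le_rfl (norm_nonneg _)) (norm_nonneg _))
      (norm_nonneg _)
  linarith

end Jet

end FracTonelli

/-! ### Tangent planes and the continuous subgradient -/

theorem barrelledSpace_of_completeSpace (X : Type*) [NormedAddCommGroup X] [NormedSpace ℝ X]
    [CompleteSpace X] : BarrelledSpace ℝ X :=
  inferInstance

/-- A differentiable convex function lies above its tangent planes. -/
theorem ConvexOn.fderiv_sub_le {X : Type*} [NormedAddCommGroup X] [NormedSpace ℝ X] {f : X → ℝ}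
    {f' : X →L[ℝ] ℝ} {x : X} (hf : ConvexOn ℝ univ f) (hx : HasFDerivAt f f' x) (y : X) :
    f' (y - x) ≤ f y - f x := by
  have hconv : ConvexOn ℝ univ (f ∘ AffineMap.lineMap (k := ℝ) x y) := by
    simpa using hf.comp_affineMap (AffineMap.lineMap x y)
  have hder : HasDerivAt (f ∘ AffineMap.lineMap (k := ℝ) x y) (f' (y - x)) 0 := by
    refine HasFDerivAt.comp_hasDerivAt (0 : ℝ) ?_ AffineMap.hasDerivAt_lineMap
    simpa using hx
  have := hconv.le_slope_of_hasDerivAt (mem_univ 0) (mem_univ 1) one_pos hder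
  simpa [slope] using this

namespace FracTonelli

variable {d : ℕ} {a b : ℝ} {p : ℝ≥0∞} [Fact (1 ≤ p)] {α : ℝ} {L : Vec4 d × ℝ → ℝ}

/-- The differential of `L(·, t)` at `x`, expressed through the partial gradients. -/
noncomputable def gradPairing (L : Vec4 d × ℝ → ℝ) (x : Vec4 d) (t : ℝ) (h : Vec4 d) : ℝ :=
  inner ℝ (partial₁ L x t) h.1 + (inner ℝ (partial₂ L x t) h.2.1 +
    (inner ℝ (partial₃ L x t) h.2.2.1 + inner ℝ (partial₄ L x t) h.2.2.2))

theorem gradPairing_add_smul (x : Vec4 d) (t : ℝ) (h k : Vec4 d) (r : ℝ) :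
    gradPairing L x t (h + r • k) = gradPairing L x t h + r * gradPairing L x t k := by
  simp only [gradPairing, Prod.fst_add, Prod.snd_add, Prod.smul_fst, Prod.smul_snd, inner_add_right,
    real_inner_smul_right]
  ring

theorem gradPairing_eq_fderiv {x : Vec4 d} {t : ℝ} {f' : Vec4 d →L[ℝ] ℝ}
    (hf : HasFDerivAt (fun z => L (z, t)) f' x) (h : Vec4 d) :
    gradPairing L x t h = f' h := by
  have h₁ : HasFDerivAt (fun y => L ((y, x.2.1, x.2.2.1, x.2.2.2), t))
      (f' ∘L .inl ℝ _ _) x.1 :=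
    HasFDerivAt.comp (g := fun z => L (z, t)) x.1 hf (hasFDerivAt_prodMk_left x.1 x.2)
  have h₂ : HasFDerivAt (fun y => L ((x.1, y, x.2.2.1, x.2.2.2), t))
      (f' ∘L .inr ℝ _ _ ∘L .inl ℝ _ _) x.2.1 :=
    HasFDerivAt.comp (g := fun z => L (z, t)) x.2.1 hf ((hasFDerivAt_prodMk_right x.1 x.2).comp
      x.2.1 (hasFDerivAt_prodMk_left x.2.1 x.2.2))
  have h₃ : HasFDerivAt (fun y => L ((x.1, x.2.1, y, x.2.2.2), t))
      (f' ∘L .inr ℝ _ _ ∘L .inr ℝ _ _ ∘L .inl ℝ _ _) x.2.2.1 :=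
    HasFDerivAt.comp (g := fun z => L (z, t)) x.2.2.1 hf ((hasFDerivAt_prodMk_right x.1 x.2).comp
      x.2.2.1 ((hasFDerivAt_prodMk_right x.2.1 x.2.2).comp x.2.2.1
        (hasFDerivAt_prodMk_left x.2.2.1 x.2.2.2)))
  have h₄ : HasFDerivAt (fun y => L ((x.1, x.2.1, x.2.2.1, y), t))
      (f' ∘L .inr ℝ _ _ ∘L .inr ℝ _ _ ∘L .inr ℝ _ _) x.2.2.2 :=
    HasFDerivAt.comp (g := fun z => L (z, t)) x.2.2.2 hf ((hasFDerivAt_prodMk_right x.1 x.2).comp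
      x.2.2.2 ((hasFDerivAt_prodMk_right x.2.1 x.2.2).comp x.2.2.2
        (hasFDerivAt_prodMk_right x.2.2.1 x.2.2.2)))
  simp only [gradPairing, partial₁, partial₂, partial₃, partial₄, gradient,
    InnerProductSpace.toDual_symm_apply, h₁.fderiv, h₂.fderiv, h₃.fderiv, h₄.fderiv,
    ContinuousLinearMap.comp_apply, ContinuousLinearMap.inl_apply, ContinuousLinearMap.inr_apply,
    ← map_add, Prod.mk_add_mk, add_zero, zero_add]

theorem gradPairing_sub_le (hL : ContDiffOn ℝ 1 L (univ ×ˢ Icc a b))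
    (hconv : ∀ t ∈ Icc a b, ConvexOn ℝ univ fun x : Vec4 d => L (x, t)) {t : ℝ}
    (ht : t ∈ Ioo a b) (x y : Vec4 d) :
    gradPairing L x t (y - x) ≤ L (y, t) - L (x, t) := by
  -- Smoothness is given only on the closed strip, so genuine differentiability requires `t` to be
  -- interior.
  have hnhds : (univ ×ˢ Icc a b : Set (Vec4 d × ℝ)) ∈ 𝓝 (x, t) :=
    prod_mem_nhds univ_mem (Icc_mem_nhds ht.1 ht.2)
  have hd : DifferentiableAt ℝ L (x, t) :=
    (hL.contDiffAt hnhds).differentiableAt (by simp)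
  have hf : HasFDerivAt (fun z => L (z, t)) _ x :=
    hd.hasFDerivAt.comp x (hasFDerivAt_prodMk_left x t)
  rw [gradPairing_eq_fderiv hf]
  exact (hconv t (Ioo_subset_Icc_self ht)).fderiv_sub_le hf y

/-- The sum of the norms of the partial gradients of `L`. -/
noncomputable def gradSize (L : Vec4 d × ℝ → ℝ) (x : Vec4 d) (t : ℝ) : ℝ :=
  ‖partial₁ L x t‖ + (‖partial₂ L x t‖ + (‖partial₃ L x t‖ + ‖partial₄ L x t‖))

theorem gradSize_nonneg (x : Vec4 d) (t : ℝ) : 0 ≤ gradSize L x t := by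
  unfold gradSize
  positivity

theorem abs_gradPairing_le (x : Vec4 d) (t : ℝ) (h : Vec4 d) :
    |gradPairing L x t h| ≤ gradSize L x t * ‖h‖ := by
  have key : ∀ (v w : Vec d), ‖w‖ ≤ ‖h‖ → |inner ℝ v w| ≤ ‖v‖ * ‖h‖ := fun v w hw =>
    (abs_real_inner_le_norm v w).trans (by gcongr)
  have h₂ : ‖h.2‖ ≤ ‖h‖ := norm_snd_le h
  have h₃ : ‖h.2.2‖ ≤ ‖h‖ := (norm_snd_le h.2).trans h₂
  unfold gradPairing gradSize
  rw [add_mul, add_mul, add_mul]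
  refine (abs_add_le _ _).trans (add_le_add (key _ _ (norm_fst_le h)) ?_)
  refine (abs_add_le _ _).trans (add_le_add (key _ _ ((norm_fst_le h.2).trans h₂)) ?_)
  exact (abs_add_le _ _).trans (add_le_add (key _ _ ((norm_fst_le h.2.2).trans h₃))
    (key _ _ ((norm_snd_le h.2.2).trans h₃)))

theorem aestronglyMeasurable_gradSize_jet (hreg : IsRegular a b p α L) (u : Sobolev d a b p) :
    AEStronglyMeasurable (fun t => gradSize L (jet α u t) t) (intervalMeasure a b) :=
  (hreg.memLp₁ u).1.norm.add ((hreg.memLp₂ u).1.norm.add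
    ((hreg.memLp₃ u).1.norm.add (hreg.memLp₄ u).1.norm))

theorem aestronglyMeasurable_gradPairing_jet (hα₀ : 0 < α) (hα₁ : α < 1)
    (hreg : IsRegular a b p α L) (u w : Sobolev d a b p) :
    AEStronglyMeasurable (fun t => gradPairing L (jet α u t) t (jet α w t))
      (intervalMeasure a b) := by
  have hw := (integrable_jet hα₀ hα₁ w).1
  exact ((hreg.memLp₁ u).1.inner hw.fst).add (((hreg.memLp₂ u).1.inner hw.snd.fst).add
    (((hreg.memLp₃ u).1.inner hw.snd.snd.fst).add ((hreg.memLp₄ u).1.inner hw.snd.snd.snd)))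

/-- The tangent-plane inequality at `u ± w` bounds plus and minus the pairing by `L` along `u ± w`
minus `L` along `u`, and both differences are integrable. -/
theorem integrable_gradPairing_jet (hα₀ : 0 < α) (hα₁ : α < 1)
    (hL : ContDiffOn ℝ 1 L (univ ×ˢ Icc a b)) (hreg : IsRegular a b p α L)
    (hconv : ∀ t ∈ Icc a b, ConvexOn ℝ univ fun x : Vec4 d => L (x, t)) (u w : Sobolev d a b p) :
    Integrable (fun t => gradPairing L (jet α u t) t (jet α w t)) (intervalMeasure a b) := by
  have hLi : ∀ v : Sobolev d a b p, Integrable (fun t => L (jet α v t, t)) (intervalMeasure a b) :=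
    fun v => memLp_one_iff_integrable.1 (hreg.memLp v)
  refine Integrable.mono' (((hLi (u + (1 : ℝ) • w)).sub (hLi u)).abs.add
    ((hLi (u + (-1 : ℝ) • w)).sub (hLi u)).abs)
    (aestronglyMeasurable_gradPairing_jet hα₀ hα₁ hreg u w) ?_
  filter_upwards [jet_add_smul hα₀ hα₁ u w 1, jet_add_smul hα₀ hα₁ u w (-1),
    ae_restrict_mem measurableSet_Ioo] with t h1 h2 ht
  have k1 := gradPairing_sub_le hL hconv ht (jet α u t) (jet α (u + (1 : ℝ) • w) t)
  have k2 := gradPairing_sub_le hL hconv ht (jet α u t) (jet α (u + (-1 : ℝ) • w) t)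
  -- Here `-h` is written `h + (-2) • h`, so that the affine identity also yields oddness.
  have hneg := gradPairing_add_smul (L := L) (jet α u t) t (jet α w t) (jet α w t) (-2)
  have e1 : jet α (u + (1 : ℝ) • w) t - jet α u t = jet α w t := by rw [h1]; module
  have e2 : jet α (u + (-1 : ℝ) • w) t - jet α u t = jet α w t + (-2 : ℝ) • jet α w t := by
    rw [h2]; module
  rw [e1] at k1
  rw [e2, hneg] at k2
  simp only [Pi.add_apply, Pi.sub_apply, Real.norm_eq_abs]
  refine abs_le.2 ⟨?_, ?_⟩
  · linarith [le_abs_self (L (jet α (u + (-1 : ℝ) • w) t, t) - L (jet α u t, t)),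
      abs_nonneg (L (jet α (u + (1 : ℝ) • w) t, t) - L (jet α u t, t))]
  · linarith [le_abs_self (L (jet α (u + (1 : ℝ) • w) t, t) - L (jet α u t, t)),
      abs_nonneg (L (jet α (u + (-1 : ℝ) • w) t, t) - L (jet α u t, t))]

/-- The functional has a continuous subgradient at every point of `W^{1,p}`: the first variation
is a pointwise limit of bounded functionals, hence bounded by the Banach--Steinhaus theorem. -/
theorem exists_subgradient (hα₀ : 0 < α) (hα₁ : α < 1)
    (hL : ContDiffOn ℝ 1 L (univ ×ˢ Icc a b)) (hreg : IsRegular a b p α L)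
    (hconv : ∀ t ∈ Icc a b, ConvexOn ℝ univ fun x : Vec4 d => L (x, t)) (u : Sobolev d a b p) :
    ∃ ℓ : Sobolev d a b p →L[ℝ] ℝ, ∀ v, functional α L u + ℓ (v - u) ≤ functional α L v := by
  have := completeSpace_sobolev (d := d) (a := a) (b := b) (p := p)
  have : BarrelledSpace ℝ (Sobolev d a b p) := barrelledSpace_of_completeSpace _
  set B : Sobolev d a b p → ℝ → ℝ := fun w t => gradPairing L (jet α u t) t (jet α w t) with hB
  have hBi : ∀ w, Integrable (B w) (intervalMeasure a b) :=
    integrable_gradPairing_jet hα₀ hα₁ hL hreg hconv u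
  have hBlin : ∀ w z (r : ℝ), B (w + r • z) =ᵐ[intervalMeasure a b] fun t => B w t + r * B z t := by
    intro w z r
    filter_upwards [jet_add_smul hα₀ hα₁ w z r] with t ht
    simp only [hB, ht, gradPairing_add_smul]
  set G : ℝ → ℝ := fun t => gradSize L (jet α u t) t with hG
  have hG0 : ∀ t, 0 ≤ G t := fun t => gradSize_nonneg _ _
  -- A soft truncation: `θ n ≤ 1`, `θ n → 1` pointwise, and `θ n * G ≤ n + 1`, so the damped pairing
  -- is bounded by a constant times the `L^1` norm of the jet.
  set θ : ℕ → ℝ → ℝ := fun n t => (1 + G t / (n + 1))⁻¹ with hθ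
  have hden : ∀ (n : ℕ) t, 1 ≤ 1 + G t / ((n : ℝ) + 1) := fun n t => by
    have := div_nonneg (hG0 t) (Nat.cast_add_one_pos n).le
    linarith
  have hθ0 : ∀ n t, 0 ≤ θ n t := fun n t => inv_nonneg.2 (zero_le_one.trans (hden n t))
  have hθ1 : ∀ n t, θ n t ≤ 1 := fun n t => inv_le_one_of_one_le₀ (hden n t)
  have hθG : ∀ n t, θ n t * G t ≤ n + 1 := fun n t => by
    have hn : (0 : ℝ) < (n : ℝ) + 1 := by positivity
    rw [hθ, inv_mul_le_iff₀ (zero_lt_one.trans_le (hden n t)), add_mul, div_mul_cancel₀ _ hn.ne']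
    linarith
  have hθm : ∀ n, AEStronglyMeasurable (θ n) (intervalMeasure a b) := fun n =>
    ((((aestronglyMeasurable_gradSize_jet hreg u).aemeasurable.div_const _).const_add
      1).inv).aestronglyMeasurable
  have hθB : ∀ n w t, ‖θ n t * B w t‖ ≤ ‖B w t‖ := fun n w t => by
    rw [norm_mul, Real.norm_of_nonneg (hθ0 n t)]
    exact mul_le_of_le_one_left (norm_nonneg _) (hθ1 n t)
  have hθi : ∀ n w, Integrable (fun t => θ n t * B w t) (intervalMeasure a b) := fun n w =>
    (hBi w).mono ((hθm n).mul (hBi w).1) (ae_of_all _ (hθB n w))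
  have hθlin : ∀ n w z (r : ℝ), ∫ t in Ioo a b, θ n t * B (w + r • z) t =
      (∫ t in Ioo a b, θ n t * B w t) + r * ∫ t in Ioo a b, θ n t * B z t := by
    intro n w z r
    rw [← integral_const_mul, ← integral_add (hθi n w) ((hθi n z).const_mul r)]
    refine integral_congr_ae ?_
    filter_upwards [hBlin w z r] with t ht
    rw [ht]
    ring
  obtain ⟨C, hC0, hC⟩ := integral_norm_jet_le (d := d) (a := a) (b := b) (p := p) hα₀ hα₁
  let A : ℕ → Sobolev d a b p →ₗ[ℝ] ℝ := fun n =>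
    { toFun := fun w => ∫ t in Ioo a b, θ n t * B w t
      map_add' := fun w z => by simpa using hθlin n w z 1
      map_smul' := fun r w => by
        have h := hθlin n w w (r - 1)
        have e : w + (r - 1) • w = r • w := by module
        rw [e] at h
        rw [h, RingHom.id_apply, smul_eq_mul]
        ring }
  have hA : ∀ n w, ‖A n w‖ ≤ (n + 1) * C * ‖w‖ := fun n w => by
    calc ‖A n w‖ ≤ ∫ t in Ioo a b, ((n : ℝ) + 1) * ‖jet α w t‖ := by
          refine norm_integral_le_of_norm_le ((integrable_jet hα₀ hα₁ w).norm.const_mul _)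
            (ae_of_all _ fun t => ?_)
          rw [norm_mul, Real.norm_of_nonneg (hθ0 n t)]
          calc θ n t * ‖B w t‖ ≤ θ n t * (G t * ‖jet α w t‖) :=
                mul_le_mul_of_nonneg_left (abs_gradPairing_le _ _ _) (hθ0 n t)
            _ = θ n t * G t * ‖jet α w t‖ := (mul_assoc _ _ _).symm
            _ ≤ (n + 1) * ‖jet α w t‖ := by gcongr; exact hθG n t
      _ = (n + 1) * ∫ t in Ioo a b, ‖jet α w t‖ := integral_const_mul _ _
      _ ≤ (n + 1) * (C * ‖w‖) := by gcongr; exact hC w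
      _ = (n + 1) * C * ‖w‖ := by ring
  have hlim : Tendsto (fun n w => (A n).mkContinuous _ (hA n) w) atTop
      (𝓝 fun w => ∫ t in Ioo a b, B w t) := by
    refine tendsto_pi_nhds.2 fun w => ?_
    change Tendsto (fun n => ∫ t in Ioo a b, θ n t * B w t) atTop _
    refine tendsto_integral_of_dominated_convergence (fun t => ‖B w t‖)
      (fun n => (hθi n w).1) (hBi w).norm (fun n => ae_of_all _ (hθB n w)) (ae_of_all _ fun t => ?_)
    have h1 : Tendsto (fun n : ℕ => G t / ((n : ℝ) + 1)) atTop (𝓝 0) :=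
      tendsto_const_nhds.div_atTop
        (tendsto_atTop_add_const_right _ _ tendsto_natCast_atTop_atTop)
    have h2 : Tendsto (fun n => θ n t) atTop (𝓝 (1 + 0)⁻¹) :=
      (h1.const_add 1).inv₀ (by norm_num)
    simpa using h2.mul_const (B w t)
  -- Banach–Steinhaus enters here: the bounds `(n + 1) * C` blow up, but pointwise convergence on a
  -- barrelled space still gives a continuous limit.
  refine ⟨continuousLinearMapOfTendsto _ hlim, fun v => ?_⟩
  change (∫ t in Ioo a b, L (jet α u t, t)) + ∫ t in Ioo a b, B (v - u) t ≤
    ∫ t in Ioo a b, L (jet α v t, t)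
  have hLi : ∀ v : Sobolev d a b p, Integrable (fun t => L (jet α v t, t)) (intervalMeasure a b) :=
    fun v => memLp_one_iff_integrable.1 (hreg.memLp v)
  rw [← integral_add (hLi u) (hBi _)]
  refine integral_mono_ae ((hLi u).add (hBi _)) (hLi v) ?_
  filter_upwards [jet_add_smul hα₀ hα₁ v u (-1), ae_restrict_mem measurableSet_Ioo] with t h1 ht
  have e : v + (-1 : ℝ) • u = v - u := by module
  have e' : jet α v t + (-1 : ℝ) • jet α u t = jet α v t - jet α u t := by module
  rw [e, e'] at h1
  have := gradPairing_sub_le hL hconv ht (jet α u t) (jet α v t)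
  simp only [hB, h1]
  linarith

end FracTonelli

/-! ### The direct method -/

/-- A coercive function on a weakly closed set of a uniformly convex Banach space that is
subdifferentiable everywhere has a minimizer. -/
theorem exists_forall_le_of_subgradient {X : Type*} [NormedAddCommGroup X] [NormedSpace ℝ X]
    [UniformConvexSpace X] [CompleteSpace X] {F : X → ℝ} {E : Set X}
    (hE : FracTonelli.IsWeaklyClosed E) (hne : E.Nonempty) (hcoer : FracTonelli.IsCoerciveOn F E)
    (hsub : ∀ u, ∃ ℓ : X →L[ℝ] ℝ, ∀ v, F u + ℓ (v - u) ≤ F v) :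
    ∃ u ∈ E, ∀ v ∈ E, F u ≤ F v := by
  have : Nonempty E := hne.to_subtype
  have hdir : Directed (· ≥ ·) fun v : E => 𝓟 {u | u ∈ E ∧ F u ≤ F v} := by
    intro v w
    rcases le_total (F v) (F w) with h | h
    · exact ⟨v, le_rfl, principal_mono.2 fun u hu => ⟨hu.1, hu.2.trans h⟩⟩
    · exact ⟨w, principal_mono.2 fun u hu => ⟨hu.1, hu.2.trans h⟩, le_rfl⟩
  have hneBot : (⨅ v : E, 𝓟 {u | u ∈ E ∧ F u ≤ F v}).NeBot :=
    iInf_neBot_of_directed hdir fun v => principal_neBot_iff.2 ⟨v, v.2, le_rfl⟩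
  let U : Ultrafilter X := Ultrafilter.of (⨅ v : E, 𝓟 {u | u ∈ E ∧ F u ≤ F v})
  have hU : ∀ v ∈ E, {u | u ∈ E ∧ F u ≤ F v} ∈ U := fun v hv =>
    Ultrafilter.of_le _ (mem_iInf_of_mem (⟨v, hv⟩ : E) (mem_principal_self _))
  obtain ⟨v₀, hv₀⟩ := hne
  -- The margin `1` makes the points of `E` outside the ball lie strictly above the level `F v₀`.
  obtain ⟨R, hR⟩ : ∃ R : ℝ, ∀ u ∈ E, R ≤ ‖u‖ → F v₀ + 1 ≤ F u := by
    have h := hcoer (Ici_mem_atTop (F v₀ + 1))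
    rw [mem_map, mem_inf_principal, mem_comap] at h
    obtain ⟨T, hT, hTE⟩ := h
    obtain ⟨R, hR⟩ := mem_atTop_sets.1 hT
    exact ⟨R, fun u hu hn => hTE (hR _ hn) hu⟩
  have hball : Metric.closedBall (0 : X) R ∈ U := by
    refine mem_of_superset (hU v₀ hv₀) fun u hu => ?_
    rw [mem_closedBall_zero_iff]
    by_contra! h
    linarith [hR u hu.1 h.le, hu.2]
  obtain ⟨x, hx⟩ := U.exists_tendsto_toWeakSpace hball
  refine ⟨x, ?_, fun v hv => ?_⟩
  · have hxE : toWeakSpace ℝ X x ∈ toWeakSpace ℝ X '' E :=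
      hE.mem_of_tendsto hx (mem_of_superset (hU v₀ hv₀) fun u hu => mem_image_of_mem _ hu.1)
    exact ((toWeakSpace ℝ X).injective.mem_set_image).1 hxE
  · obtain ⟨ℓ, hℓ⟩ := hsub x
    have hℓx : Tendsto (fun u => F x + ℓ (u - x)) U (𝓝 (F x + ℓ (x - x))) := by
      have h : Tendsto ℓ U (𝓝 (ℓ x)) :=
        ((WeakBilin.eval_continuous (topDualPairing ℝ X).flip ℓ).tendsto
          (toWeakSpace ℝ X x)).comp hx
      simp only [map_sub]
      exact (h.sub_const _).const_add _
    rw [sub_self, map_zero, add_zero] at hℓx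
    exact le_of_tendsto hℓx (mem_of_superset (hU v hv) fun u hu => (hℓ u).trans hu.2)

theorem theorem1 (d : ℕ) (hd : 0 < d) (a b : ℝ) (hab : a < b)
    (p : ℝ≥0∞) [Fact (1 ≤ p)] (hp₁ : 1 < p) (hp : p ≠ ⊤)
    (α : ℝ) (hα₀ : 0 < α) (hα₁ : α < 1)
    (E : Set (FracTonelli.Sobolev d a b p)) (hE : FracTonelli.IsWeaklyClosed E)
    (hne : E.Nonempty)
    (L : FracTonelli.Vec4 d × ℝ → ℝ) (hL : ContDiffOn ℝ 1 L (univ ×ˢ Icc a b))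
    (hreg : FracTonelli.IsRegular a b p α L)
    (hcoer : FracTonelli.IsCoerciveOn
      (FracTonelli.functional α L : FracTonelli.Sobolev d a b p → ℝ) E)
    (hconv : ∀ t ∈ Icc a b, ConvexOn ℝ univ (fun x : FracTonelli.Vec4 d => L (x, t))) :
    ∃ u ∈ E, ∀ v ∈ E, FracTonelli.functional α L u ≤ FracTonelli.functional α L v := by
  have := FracTonelli.uniformConvexSpace_sobolev (d := d) (a := a) (b := b) hp₁ hp
  have := FracTonelli.completeSpace_sobolev (d := d) (a := a) (b := b) (p := p)
  exact exists_forall_le_of_subgradient hE hne hcoer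
    (FracTonelli.exists_subgradient hα₀ hα₁ hL hreg hconv)
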